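/- Let $k$ be an infinite field and let $S=k[x_0,x_1,y_0,y_1]$ be bigraded by $\deg x_i=(1,0)$, $\deg y_j=(0,1)$. For a bihomogeneous ideal $I\subset S$ the quotient $R=S/I$ is bigraded, $R=\bigoplus_{i,j\ge 0}R_{i,j}$, and its Hilbert series is $R(u,v)=\sum_{i,j\ge0}\dim_k(R_{i,j})\,u^iv^j$. Hilbert series are partially ordered termwise: $\sum a_{ij}u^iv^j\ge\sum b_{ij}u^iv^j$ if $a_{ij}\ge b_{ij}$ for all $i,j$. Fix $r\ge 0$ and bidegrees $\mathbf d_i=(d_i,e_i)\in\mathbb Z_{\ge0}^2$, $i=1,\dots,r$, and let $\mathbf I_{\mathbf d_1,\dots,\mathbf d_r}$ be the set of ideals $(f_1,\dots,f_r)\subset S$ with each $f_i$ bihomogeneous of bidegree $\mathbf d_i$ (the zero polynomial being allowed). Writing $f_i$ as a linear combination of the $(d_i+1)(e_i+1)$ monomials of bidegree $\mathbf d_i$, every point $a\in\mathbb A^N(k)=k^N$, $N=\sum_{i=1}^r(d_i+1)(e_i+1)$, determines an ideal $I_a\in\mathbf I_{\mathbf d_1,\dots,\mathbf d_r}$. **Theorem.**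 1. Only finitely many power series occur as the Hilbert series of $S/I$ with $I\in\mathbf I_{\mathbf d_1,\dots,\mathbf d_r}$. 2. There are a nonempty Zariski-open subset $U\subset k^N$ and a power series $H(u,v)$ such that the Hilbert series of $S/I_a$ equals $H$ for all $a\in U$. 3. This $H$ is the smallest series that occurs: it is the Hilbert series of $S/I$ for some $I\in\mathbf I_{\mathbf d_1,\dots,\mathbf d_r}$, and $H$ is termwise less than or equal to the Hilbert series of $S/I$ for every $I\in\mathbf I_{\mathbf d_1,\dots,\mathbf d_r}$. -/

import Mathlib

noncomputable section

namespace BiProj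

/-- The coordinate ring `k[x₀, x₁, y₀, y₁]` of `ℙ¹ × ℙ¹`: the left summand indexes the `x`'s,
the right summand indexes the `y`'s. -/
abbrev CoordRing (k : Type*) [Field k] : Type _ := MvPolynomial (Fin 2 ⊕ Fin 2) k

/-- The bidegrees of the variables: `deg xᵢ = (1, 0)` and `deg yⱼ = (0, 1)`. -/
def varDeg : Fin 2 ⊕ Fin 2 → ℕ × ℕ := Sum.elim (fun _ => (1, 0)) (fun _ => (0, 1))

/-- The space of bihomogeneous polynomials of bidegree `d` (including `0`). -/
def forms (k : Type*) [Field k] (d : ℕ × ℕ) : Submodule k (CoordRing k) :=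
  MvPolynomial.weightedHomogeneousSubmodule k varDeg d

/-- The component of bidegree `d` of the quotient of the coordinate ring by `I`. -/
def quotPiece {k : Type*} [Field k] (I : Ideal (CoordRing k)) (d : ℕ × ℕ) :
    Submodule k (CoordRing k ⧸ I) :=
  (forms k d).map (Ideal.Quotient.mkₐ k I).toLinearMap

/-- The bigraded Hilbert series `∑ dim_k R_{i,j} uⁱ vʲ` of the quotient `R` of the coordinate ring
by `I`, where `u`, `v` are the variables number `0` and `1`. -/
def hilbertSeries {k : Type*} [Field k] (I : Ideal (CoordRing k)) : MvPowerSeries (Fin 2) ℕ :=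
  fun m => Module.finrank k (quotPiece I (m 0, m 1))

/-- The termwise partial order on power series in `u`, `v`. -/
def TermwiseLE (G H : MvPowerSeries (Fin 2) ℕ) : Prop :=
  ∀ m : Fin 2 →₀ ℕ, MvPowerSeries.coeff m G ≤ MvPowerSeries.coeff m H

/-- The ideals generated by `f₁, …, f_r` with `fᵢ` bihomogeneous of bidegree `dᵢ`. -/
def idealSpace (k : Type*) [Field k] {r : ℕ} (d : Fin r → ℕ × ℕ) : Set (Ideal (CoordRing k)) :=
  {I | ∃ f : Fin r → CoordRing k, (∀ i, f i ∈ forms k (d i)) ∧ I = Ideal.span (Set.range f)}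

/-- Indices of the coefficients of `r` forms of bidegrees `d₁, …, d_r`. -/
abbrev CoeffIndex {r : ℕ} (d : Fin r → ℕ × ℕ) : Type :=
  (i : Fin r) × (Fin ((d i).1 + 1) × Fin ((d i).2 + 1))

/-- The dimension of the coefficient space is `N = ∑ (dᵢ + 1)(eᵢ + 1)`. -/
theorem card_coeffIndex {r : ℕ} (d : Fin r → ℕ × ℕ) :
    Fintype.card (CoeffIndex d) = ∑ i, ((d i).1 + 1) * ((d i).2 + 1) := by
  simp [CoeffIndex]

/-- The `i`-th form with coefficient vector `a`:
`∑ a_{i,p,q} x₀^(dᵢ-p) x₁^p y₀^(eᵢ-q) y₁^q` over `0 ≤ p ≤ dᵢ`, `0 ≤ q ≤ eᵢ`. -/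
def formOfPoint {k : Type*} [Field k] {r : ℕ} (d : Fin r → ℕ × ℕ) (a : CoeffIndex d → k)
    (i : Fin r) : CoordRing k :=
  ∑ p : Fin ((d i).1 + 1), ∑ q : Fin ((d i).2 + 1),
    MvPolynomial.C (a ⟨i, (p, q)⟩) *
      (MvPolynomial.X (Sum.inl 0) ^ ((d i).1 - (p : ℕ)) * MvPolynomial.X (Sum.inl 1) ^ (p : ℕ) *
        MvPolynomial.X (Sum.inr 0) ^ ((d i).2 - (q : ℕ)) * MvPolynomial.X (Sum.inr 1) ^ (q : ℕ))

/-- The ideal that corresponds to a point of the coefficient space `𝔸ᴺ`. -/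
def idealOfPoint {k : Type*} [Field k] {r : ℕ} (d : Fin r → ℕ × ℕ) (a : CoeffIndex d → k) :
    Ideal (CoordRing k) :=
  Ideal.span (Set.range (formOfPoint d a))

/-- A set of `k`-points of affine space is Zariski-open if its complement is the set of common
zeros of a set of polynomials over `k`. -/
def IsZariskiOpen {k : Type*} [Field k] {σ : Type*} (U : Set (σ → k)) : Prop :=
  ∃ P : Set (MvPolynomial σ k), Uᶜ = {a | ∀ p ∈ P, MvPolynomial.eval a p = 0}

end BiProj

end

/-! The series of `S/I_a` is determined by the dimensions of the pieces `(I_a)_m`. All `I_a` are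
specialisations of one ideal with indeterminate coefficients, so independent elements of `(I_a)_m`
lift and stay independent wherever a determinant is nonzero: these dimensions are lower
semicontinuous (`exists_eval_ne_zero_forall_finrank_le`).

Finiteness needs a bound in all bidegrees at once. Let `J` be prime with generic point `b`. By
Dickson's lemma, finitely many elements of `I_b` have leading exponents below all others. Where the
leading coefficients of their lifts do not vanish, the leading exponents survive, so every `(I_a)_m`
is at least as large as `(I_b)_m` (`exists_aeval_ne_zero_forall_finrank_le`). With semicontinuity,
the series is constant on the zeros of `J` outside those of some `f ∉ J`, and Noetherian induction
concludes (`finite_image_hilbertSeries`).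

As only finitely many series occur, finitely many bidegrees separate the termwise minimum from the
others, and a finite product of semicontinuity polynomials defines `U`. -/

open MvPolynomial

/-! ### Leading exponents, Dickson's lemma, dual families -/

/-- The exponents of the leading monomials of the nonzero elements of a space of polynomials. -/
def MonomialOrder.leadingExponents {σ K : Type*} [Field K] (ord : MonomialOrder σ)
    (V : Submodule K (MvPolynomial σ K)) : Set (σ →₀ ℕ) :=
  {s | ∃ g ∈ V, g ≠ 0 ∧ ord.degree g = s}

/-- In a vanishing combination, the largest leading monomial among the terms with nonzero
coefficient cannot cancel. -/
theorem MonomialOrder.linearIndependent_of_injective_degree {σ K ι : Type*} [Field K]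
    (ord : MonomialOrder σ) (g : ι → MvPolynomial σ K) (hg : ∀ i, g i ≠ 0)
    (hinj : Function.Injective fun i => ord.degree (g i)) : LinearIndependent K g := by
  classical
  rw [linearIndependent_iff']
  intro s c hsum
  by_contra! hne
  obtain ⟨i₀, hi₀, hc₀⟩ := hne
  obtain ⟨i, hi, hmax⟩ := Finset.exists_max_image (s.filter fun i => c i ≠ 0)
    (fun i => ord.toSyn (ord.degree (g i))) ⟨i₀, by simp [hi₀, hc₀]⟩
  rw [Finset.mem_filter] at hi
  have h := congrArg (coeff (ord.degree (g i))) hsum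
  rw [coeff_sum, Finset.sum_eq_single i, coeff_smul, coeff_zero, smul_eq_mul, mul_eq_zero] at h
  · exact h.elim hi.2 (ord.coeff_degree_ne_zero_iff.2 (hg i))
  · intro j hj hji
    by_cases hcj : c j = 0
    · simp [hcj]
    · rw [coeff_smul, ord.coeff_eq_zero_of_lt, smul_zero]
      refine lt_of_le_of_ne (hmax j (by simp [hj, hcj])) fun he => hji (hinj ?_)
      exact ord.toSyn.injective he
  · exact fun h => absurd hi.1 h

/-- One element of `V` per leading exponent gives a basis: subtracting multiples lowers the leading
monomial, and monomial orders are well-founded. -/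
theorem MonomialOrder.card_leadingExponents {σ K : Type*} [Field K] (ord : MonomialOrder σ)
    (V : Submodule K (MvPolynomial σ K)) :
    Nat.card (ord.leadingExponents V) = Module.finrank K V := by
  choose g hgV hg0 hgdeg using fun s : ord.leadingExponents V => s.2
  have hli : LinearIndependent K g := ord.linearIndependent_of_injective_degree g hg0
    fun s t h => Subtype.ext ((hgdeg s).symm.trans (h.trans (hgdeg t)))
  have hspan : V ≤ Submodule.span K (Set.range g) := by
    have key : ∀ (n : ord.syn) (f : MvPolynomial σ K), ord.toSyn (ord.degree f) = n → f ∈ V →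
        f ∈ Submodule.span K (Set.range g) := by
      intro n
      induction n using WellFoundedLT.induction with
      | ind n ih =>
        intro f hn hf
        by_cases hf0 : f = 0
        · exact hf0 ▸ Submodule.zero_mem _
        let s : ord.leadingExponents V := ⟨ord.degree f, f, hf, hf0, rfl⟩
        have hs : ord.degree (g s) = ord.degree f := hgdeg s
        have hlc : coeff (ord.degree f) (g s) ≠ 0 := by
          rw [← hs]; exact ord.coeff_degree_ne_zero_iff.2 (hg0 s)
        let c := coeff (ord.degree f) f / coeff (ord.degree f) (g s)
        have hgs : c • g s ∈ Submodule.span K (Set.range g) :=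
          Submodule.smul_mem _ _ (Submodule.subset_span ⟨s, rfl⟩)
        rw [← sub_add_cancel f (c • g s)]
        refine Submodule.add_mem _ ?_ hgs
        by_cases h0 : f - c • g s = 0
        · exact h0 ▸ Submodule.zero_mem _
        refine ih _ ?_ _ rfl (V.sub_mem hf (V.smul_mem _ (hgV s)))
        subst hn
        by_contra hlt
        rw [not_lt] at hlt
        refine ord.coeff_degree_ne_zero_iff.2 h0 ?_
        rcases hlt.lt_or_eq with h | h
        · rw [coeff_sub, coeff_smul, ord.coeff_eq_zero_of_lt h,
            ord.coeff_eq_zero_of_lt (by rw [hs]; exact h)]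
          simp
        · rw [← ord.toSyn.injective h, coeff_sub, coeff_smul, smul_eq_mul,
            div_mul_cancel₀ _ hlc, sub_self]
    exact fun f hf => key _ f rfl hf
  have hV : Submodule.span K (Set.range g) = V :=
    le_antisymm (Submodule.span_le.2 (Set.range_subset_iff.2 hgV)) hspan
  rw [← hV, Module.finrank_eq_nat_card_basis (Module.Basis.span hli), hV]

theorem MonomialOrder.finite_leadingExponents {σ K : Type*} [Field K] (ord : MonomialOrder σ)
    (V : Submodule K (MvPolynomial σ K)) [Module.Finite K V] : (ord.leadingExponents V).Finite := by
  choose g hgV hg0 hgdeg using fun s : ord.leadingExponents V => s.2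
  have hli : LinearIndependent K g := ord.linearIndependent_of_injective_degree g hg0
    fun s t h => Subtype.ext ((hgdeg s).symm.trans (h.trans (hgdeg t)))
  have hli' : LinearIndependent K fun s => (⟨g s, hgV s⟩ : V) :=
    LinearIndependent.of_comp V.subtype hli
  exact Set.finite_coe_iff.1 hli'.finite

/-- Dickson's lemma: finitely many elements of a set in a well-quasi-ordered type lie below all
its elements. -/
theorem exists_finite_subset_forall_exists_le {α : Type*} [PartialOrder α] [WellQuasiOrderedLE α]
    (S : Set α) : ∃ T ⊆ S, T.Finite ∧ ∀ s ∈ S, ∃ t ∈ T, t ≤ s := by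
  refine ⟨{t | Minimal (· ∈ S) t}, fun t ht => ht.1, ?_, fun s hs => ?_⟩
  · exact WellQuasiOrderedLE.finite_of_isAntichain (setOfPred_minimal_antichain _)
  · obtain ⟨t, hts, ht⟩ := exists_minimal_le_of_wellFoundedLT (· ∈ S) s hs
    exact ⟨t, ht, hts⟩

/-- A linearly independent family of vectors has a dual family of linear forms. -/
theorem LinearIndependent.exists_dual_family {K V ι : Type*} [Field K] [AddCommGroup V]
    [Module K V] [DecidableEq ι] {v : ι → V} (hv : LinearIndependent K v) :
    ∃ l : ι → V →ₗ[K] K, ∀ i j, l i (v j) = if i = j then 1 else 0 := by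
  obtain ⟨f, hf⟩ := hv.repr.exists_extend
  have h : ∀ j, f (v j) = Finsupp.single j 1 := fun j => by
    have := LinearMap.congr_fun hf ⟨v j, Submodule.subset_span ⟨j, rfl⟩⟩
    rw [LinearMap.comp_apply] at this
    exact this.trans (hv.repr_eq_single j _ rfl)
  refine ⟨fun i => Finsupp.lapply i ∘ₗ f, fun i j => ?_⟩
  simp [h, Finsupp.single_apply, eq_comm]

/-! ### Bihomogeneous forms and the generic ideal -/

namespace BiProj

open Sum

theorem weight_varDeg (s : Fin 2 ⊕ Fin 2 →₀ ℕ) :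
    Finsupp.weight varDeg s = (s (inl 0) + s (inl 1), s (inr 0) + s (inr 1)) := by
  rw [Finsupp.weight_apply, Finsupp.sum_fintype _ _ (by simp)]
  ext <;> simp [varDeg, Fintype.sum_sum_type, Fin.sum_univ_two]

section Generic

variable {r : ℕ} (d : Fin r → ℕ × ℕ)

/-- The monomial `x₀^(m-p) x₁^p y₀^(n-q) y₁^q` of bidegree `(m, n)`. -/
noncomputable def bimonomial (R : Type*) [CommSemiring R] (m : ℕ × ℕ) (p : Fin (m.1 + 1)) (q : Fin (m.2 + 1)) :
    MvPolynomial (Fin 2 ⊕ Fin 2) R :=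
  X (inl 0) ^ (m.1 - (p : ℕ)) * X (inl 1) ^ (p : ℕ) *
    X (inr 0) ^ (m.2 - (q : ℕ)) * X (inr 1) ^ (q : ℕ)

theorem map_bimonomial {R R' : Type*} [CommSemiring R] [CommSemiring R'] (φ : R →+* R')
    (m : ℕ × ℕ) (p : Fin (m.1 + 1)) (q : Fin (m.2 + 1)) :
    map φ (bimonomial R m p q) = bimonomial R' m p q := by
  simp [bimonomial]

theorem bimonomial_mem_forms {K : Type*} [Field K]
    (m : ℕ × ℕ) (p : Fin (m.1 + 1)) (q : Fin (m.2 + 1)) : bimonomial K m p q ∈ forms K m := by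
  have h := (((isWeightedHomogeneous_X K varDeg (inl 0)).pow (m.1 - (p : ℕ))).mul
    ((isWeightedHomogeneous_X K varDeg (inl 1)).pow (p : ℕ))).mul
    ((isWeightedHomogeneous_X K varDeg (inr 0)).pow (m.2 - (q : ℕ))) |>.mul
    ((isWeightedHomogeneous_X K varDeg (inr 1)).pow (q : ℕ))
  have hm : (m.1 - (p : ℕ)) • varDeg (inl 0) + (p : ℕ) • varDeg (inl 1) +
      (m.2 - (q : ℕ)) • varDeg (inr 0) + (q : ℕ) • varDeg (inr 1) = m := by
    have := p.2
    have := q.2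
    ext <;> simp [varDeg] <;> omega
  rw [hm] at h
  exact h

theorem forms_eq_span (K : Type*) [Field K] (m : ℕ × ℕ) :
    forms K m = Submodule.span K
      (Set.range fun x : Fin (m.1 + 1) × Fin (m.2 + 1) => bimonomial K m x.1 x.2) := by
  refine le_antisymm (fun f hf => ?_) (Submodule.span_le.2 ?_)
  · rw [f.as_sum]
    refine Submodule.sum_mem _ fun s hs => ?_
    have hw : Finsupp.weight varDeg s = m := hf (mem_support_iff.1 hs)
    rw [weight_varDeg] at hw
    obtain ⟨m₁, m₂⟩ := m
    obtain ⟨h₁, h₂⟩ := Prod.mk.inj hw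
    rw [← mul_one (coeff s f), ← smul_eq_mul, ← smul_monomial]
    refine Submodule.smul_mem _ _ (Submodule.subset_span
      ⟨(⟨s (inl 1), by simp; omega⟩, ⟨s (inr 1), by simp; omega⟩), ?_⟩)
    rw [monomial_eq, Finsupp.prod_fintype _ _ (by simp)]
    simp only [bimonomial, Fintype.prod_sum_type, Fin.prod_univ_two, map_one, one_mul, ← h₁, ← h₂,
      Nat.add_sub_cancel_right]
    ring
  · rintro _ ⟨x, rfl⟩
    exact bimonomial_mem_forms _ _ _

instance (K : Type*) [Field K] (m : ℕ × ℕ) : Module.Finite K (forms K m) := by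
  rw [forms_eq_span]
  exact Module.Finite.span_of_finite K (Set.finite_range _)

theorem formOfPoint_eq {K : Type*} [Field K] (b : CoeffIndex d → K) (i : Fin r) :
    formOfPoint d b i = ∑ x : Fin ((d i).1 + 1) × Fin ((d i).2 + 1),
      b ⟨i, x⟩ • bimonomial K (d i) x.1 x.2 := by
  simp [formOfPoint, bimonomial, Fintype.sum_prod_type, smul_eq_C_mul]

theorem formOfPoint_mem_forms {K : Type*} [Field K] (b : CoeffIndex d → K) (i : Fin r) :
    formOfPoint d b i ∈ forms K (d i) := by
  rw [formOfPoint_eq]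
  exact Submodule.sum_mem _ fun x _ => Submodule.smul_mem _ _ (bimonomial_mem_forms _ _ _)

theorem idealSpace_eq_range (K : Type*) [Field K] :
    idealSpace K d = Set.range (idealOfPoint (k := K) d) := by
  ext I
  constructor
  · rintro ⟨f, hf, rfl⟩
    have h : ∀ i, ∃ c : Fin ((d i).1 + 1) × Fin ((d i).2 + 1) → K,
        ∑ x, c x • bimonomial K (d i) x.1 x.2 = f i := fun i => by
      have := hf i
      rw [forms_eq_span] at this
      exact (Submodule.mem_span_range_iff_exists_fun K).1 this
    choose c hc using h
    refine ⟨fun x => c x.1 x.2, ?_⟩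
    have : formOfPoint d (fun x => c x.1 x.2) = f := funext fun i => by
      rw [formOfPoint_eq]; exact hc i
    rw [idealOfPoint, this]
  · rintro ⟨b, rfl⟩
    exact ⟨_, formOfPoint_mem_forms d b, rfl⟩

variable (k : Type*) [Field k]

/-- The ideal generated by the forms of bidegrees `d₁, …, d_r` with indeterminate coefficients. -/
noncomputable def genericIdeal : Ideal (MvPolynomial (Fin 2 ⊕ Fin 2) (MvPolynomial (CoeffIndex d) k)) :=
  Ideal.span (Set.range fun i => ∑ x : Fin ((d i).1 + 1) × Fin ((d i).2 + 1),
    C (X ⟨i, x⟩) * bimonomial _ (d i) x.1 x.2)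

variable {k}

theorem map_genericIdeal {K : Type*} [Field K] [Algebra k K] (b : CoeffIndex d → K) :
    (genericIdeal d k).map (map (aeval b : _ →ₐ[k] K).toRingHom) = idealOfPoint d b := by
  rw [genericIdeal, Ideal.map_span, idealOfPoint, ← Set.range_comp]
  congr 2
  funext i
  simp [formOfPoint_eq, map_bimonomial, smul_eq_C_mul]

theorem map_mem_idealOfPoint {K : Type*} [Field K] [Algebra k K] (b : CoeffIndex d → K)
    {G : MvPolynomial (Fin 2 ⊕ Fin 2) (MvPolynomial (CoeffIndex d) k)} (hG : G ∈ genericIdeal d k) :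
    map (aeval b : _ →ₐ[k] K).toRingHom G ∈ idealOfPoint d b := by
  rw [← map_genericIdeal (k := k)]
  exact Ideal.mem_map_of_mem _ hG

theorem exists_map_eq_of_mem_idealOfPoint (a : CoeffIndex d → k) {g : CoordRing k}
    (hg : g ∈ idealOfPoint d a) :
    ∃ G ∈ genericIdeal d k, map (aeval a : _ →ₐ[k] k).toRingHom G = g := by
  rw [← map_genericIdeal (k := k), Ideal.mem_map_iff_of_surjective] at hg
  · exact hg
  · exact map_surjective _ fun c => ⟨C c, by simp⟩

theorem weightedHomogeneousComponent_mem_idealOfPoint {K : Type*} [Field K]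
    (b : CoeffIndex d → K) {g : CoordRing K} (hg : g ∈ idealOfPoint d b) (m : ℕ × ℕ) :
    weightedHomogeneousComponent varDeg m g ∈ idealOfPoint d b := by
  let := weightedGradedAlgebra K varDeg
  refine weightedHomogeneousComponent_mem_of_mem K varDeg ?_ hg m
  refine Ideal.homogeneous_span _ _ ?_
  rintro _ ⟨i, rfl⟩
  exact ⟨d i, formOfPoint_mem_forms d b i⟩

/-- The component of bidegree `m` of an ideal. -/
noncomputable def idealPiece {K : Type*} [Field K] (I : Ideal (CoordRing K)) (m : ℕ × ℕ) :
    Submodule K (CoordRing K) :=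
  forms K m ⊓ I.restrictScalars K

instance {K : Type*} [Field K] (I : Ideal (CoordRing K)) (m : ℕ × ℕ) :
    Module.Finite K (idealPiece I m) :=
  Submodule.finiteDimensional_of_le inf_le_left

theorem finrank_quotPiece_add {K : Type*} [Field K] (I : Ideal (CoordRing K)) (m : ℕ × ℕ) :
    Module.finrank K (quotPiece I m) + Module.finrank K (idealPiece I m) =
      Module.finrank K (forms K m) := by
  have h := ((Ideal.Quotient.mkₐ K I).toLinearMap.domRestrict (forms K m)).finrank_range_add_finrank_ker
  rw [LinearMap.range_domRestrict, LinearMap.ker_domRestrict, ← Submodule.finrank_map_subtype_eq,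
    Submodule.map_comap_subtype] at h
  have hker : LinearMap.ker (Ideal.Quotient.mkₐ K I).toLinearMap = I.restrictScalars K := by
    ext x
    simp [Ideal.Quotient.eq_zero_iff_mem]
  rwa [hker] at h

end Generic
end BiProj

/-! ### Comparing the ideals of two points -/

namespace BiProj

section Comparison

universe u

variable {r : ℕ} (d : Fin r → ℕ × ℕ) {k : Type u} [Field k]

/-- Lower semicontinuity of the dimension of the pieces of `idealOfPoint`. -/
theorem exists_eval_ne_zero_forall_finrank_le (a : CoeffIndex d → k) (m : ℕ × ℕ) :
    ∃ p : MvPolynomial (CoeffIndex d) k, eval a p ≠ 0 ∧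
      ∀ (K : Type u) [Field K] [Algebra k K] (b : CoeffIndex d → K), aeval b p ≠ 0 →
        Module.finrank k (idealPiece (idealOfPoint d a) m) ≤
          Module.finrank K (idealPiece (idealOfPoint d b) m) := by
  classical
  let v := Module.finBasis k (idealPiece (idealOfPoint d a) m)
  have hli : LinearIndependent k fun j => (v j : CoordRing k) :=
    v.linearIndependent.map' (Submodule.subtype _) (Submodule.ker_subtype _)
  choose G hG hGv using fun j => exists_map_eq_of_mem_idealOfPoint d a (v j).2.2
  obtain ⟨l, hl⟩ := hli.exists_dual_family
  let E := Finset.univ.biUnion fun j => (v j : CoordRing k).support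
  have hE : ∀ s ∈ E, Finsupp.weight varDeg s = m := fun s hs => by
    obtain ⟨j, -, hj⟩ := Finset.mem_biUnion.1 hs
    exact (v j).2.1 (mem_support_iff.1 hj)
  -- The dual forms `l i` applied to the lifts `G j`, truncated to `E`; at `a` this is the identity
  -- matrix.
  let P : Matrix _ _ (MvPolynomial (CoeffIndex d) k) :=
    Matrix.of fun j i => ∑ s ∈ E, C (l i (monomial s 1)) * coeff s (G j)
  refine ⟨P.det, ?_, fun K _ _ b hb => ?_⟩
  · have hP : (eval a).mapMatrix P = 1 := by
      ext j i
      have hsum : (v j : CoordRing k) =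
          ∑ s ∈ E, coeff s (v j : CoordRing k) • monomial s (1 : k) := by
        conv_lhs => rw [(v j : CoordRing k).as_sum]
        rw [Finset.sum_subset (Finset.subset_biUnion_of_mem
          (fun j => (v j : CoordRing k).support) (Finset.mem_univ j))]
        · exact Finset.sum_congr rfl fun s _ => by simp [smul_monomial]
        · intro s _ hs
          rw [notMem_support_iff.1 hs, monomial_zero]
      have hcoeff : ∀ s, eval a (coeff s (G j)) = coeff s (v j : CoordRing k) := fun s => by
        rw [← hGv j, coeff_map]
        simp
      have hPji : P j i = ∑ s ∈ E, C (l i (monomial s 1)) * coeff s (G j) := rfl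
      simp only [RingHom.mapMatrix_apply, Matrix.map_apply, Matrix.one_apply, hPji,
        eq_comm (a := j), ← hl i j]
      conv_rhs => rw [hsum]
      simp [hcoeff, mul_comm]
    rw [RingHom.map_det, hP, Matrix.det_one]
    exact one_ne_zero
  · let φ : MvPolynomial (CoeffIndex d) k →+* K := (aeval b : _ →ₐ[k] K).toRingHom
    -- The lifts need not be bihomogeneous. Taking components of bidegree `m` leaves the
    -- coefficients at `E` unchanged.
    let w := fun j => weightedHomogeneousComponent varDeg m (map φ (G j))
    have hw : ∀ j, w j ∈ idealPiece (idealOfPoint d b) m := fun j =>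
      ⟨weightedHomogeneousComponent_mem _ _ _, weightedHomogeneousComponent_mem_idealOfPoint d b
        (map_mem_idealOfPoint d b (hG j)) m⟩
    let Φ : CoordRing K →ₗ[K] (Fin _ → K) :=
      LinearMap.pi fun i => ∑ s ∈ E, algebraMap k K (l i (monomial s 1)) • lcoeff K s
    have hΦ : (fun j => Φ (w j)) = (φ.mapMatrix P).row := by
      funext j i
      simp only [Φ, w, P, LinearMap.pi_apply, LinearMap.sum_apply, LinearMap.smul_apply,
        lcoeff_apply, RingHom.mapMatrix_apply, Matrix.row, Matrix.map_apply, Matrix.of_apply,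
        map_sum, map_mul, smul_eq_mul]
      refine Finset.sum_congr rfl fun s hs => ?_
      rw [coeff_weightedHomogeneousComponent, if_pos (hE s hs), coeff_map]
      simp [φ]
    have hdet : (φ.mapMatrix P).det ≠ 0 := by
      rw [← RingHom.map_det]
      exact hb
    have hliw : LinearIndependent K w := by
      refine LinearIndependent.of_comp Φ ?_
      change LinearIndependent K fun j => Φ (w j)
      rw [hΦ]
      exact Matrix.linearIndependent_rows_of_det_ne_zero hdet
    have hliw' : LinearIndependent K
        fun j => (⟨w j, hw j⟩ : idealPiece (idealOfPoint d b) m) :=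
      LinearIndependent.of_comp (Submodule.subtype _) hliw
    simpa using hliw'.fintype_card_le_finrank

/-- Denominators can be cleared in the elements of the ideal of a point all whose coordinates are
quotients of polynomial functions. -/
theorem exists_map_eq_C_mul {K : Type*} [Field K] [Algebra k K] (b : CoeffIndex d → K)
    (hb : ∀ x : K, ∃ u v : MvPolynomial (CoeffIndex d) k,
      aeval b v ≠ 0 ∧ x * aeval b v = aeval b u)
    {g : CoordRing K} (hg : g ∈ idealOfPoint d b) :
    ∃ G ∈ genericIdeal d k, ∃ c : K, c ≠ 0 ∧
      map (aeval b : _ →ₐ[k] K).toRingHom G = C c * g := by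
  suffices h : ∃ G ∈ genericIdeal d k, ∃ v : MvPolynomial (CoeffIndex d) k, aeval b v ≠ 0 ∧
      map (aeval b : _ →ₐ[k] K).toRingHom G = C (aeval b v) * g by
    obtain ⟨G, hG, v, hv, h⟩ := h
    exact ⟨G, hG, _, hv, h⟩
  rw [← map_genericIdeal (k := k)] at hg
  induction hg using Submodule.span_induction with
  | mem x hx =>
    obtain ⟨G, hG, rfl⟩ := hx
    exact ⟨G, hG, 1, by simp, by simp⟩
  | zero => exact ⟨0, Ideal.zero_mem _, 1, by simp, by simp⟩
  | add x y _ _ hx hy =>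
    obtain ⟨G, hG, v, hv, h⟩ := hx
    obtain ⟨G', hG', v', hv', h'⟩ := hy
    refine ⟨C v' * G + C v * G', Ideal.add_mem _ (Ideal.mul_mem_left _ _ hG)
      (Ideal.mul_mem_left _ _ hG'), v * v', by simp [hv, hv'], ?_⟩
    simp only [map_add, map_mul, h, h', map_C]
    simp
    ring
  | smul p x _ hx =>
    rw [smul_eq_mul]
    -- The coefficients of the multiplier lie in `K`, so their denominators must be cleared too.
    induction p using MvPolynomial.induction_on generalizing x with
    | C c =>
      obtain ⟨G, hG, v, hv, h⟩ := hx
      obtain ⟨u, v', hv', hu⟩ := hb c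
      refine ⟨C u * G, Ideal.mul_mem_left _ _ hG, v * v', by simp [hv, hv'], ?_⟩
      rw [map_mul, h, map_C]
      simp [← hu]
      ring
    | add p q hp hq =>
      obtain ⟨G, hG, v, hv, h⟩ := hp x ‹_› hx
      obtain ⟨G', hG', v', hv', h'⟩ := hq x ‹_› hx
      refine ⟨C v' * G + C v * G', Ideal.add_mem _ (Ideal.mul_mem_left _ _ hG)
        (Ideal.mul_mem_left _ _ hG'), v * v', by simp [hv, hv'], ?_⟩
      simp only [map_add, map_mul, h, h', map_C]
      simp
      ring
    | mul_X p i hp =>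
      obtain ⟨G, hG, v, hv, h⟩ := hp x ‹_› hx
      refine ⟨X i * G, Ideal.mul_mem_left _ _ hG, v, hv, ?_⟩
      rw [map_mul, h, map_X]
      ring

/-- The dimensions of the pieces of the ideal of a generic point `b` of a closed set are bounded by
those at the points of a nonempty open subset. -/
theorem exists_aeval_ne_zero_forall_finrank_le (ord : MonomialOrder (Fin 2 ⊕ Fin 2))
    {K : Type*} [Field K] [Algebra k K] (b : CoeffIndex d → K)
    (hb : ∀ x : K, ∃ u v : MvPolynomial (CoeffIndex d) k,
      aeval b v ≠ 0 ∧ x * aeval b v = aeval b u) :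
    ∃ f : MvPolynomial (CoeffIndex d) k, aeval b f ≠ 0 ∧
      ∀ a : CoeffIndex d → k, (∀ p : MvPolynomial (CoeffIndex d) k, aeval b p = 0 → eval a p = 0) →
        eval a f ≠ 0 → ∀ m, Module.finrank K (idealPiece (idealOfPoint d b) m) ≤
          Module.finrank k (idealPiece (idealOfPoint d a) m) := by
  classical
  let S := ⋃ m, ord.leadingExponents (idealPiece (idealOfPoint d b) m)
  obtain ⟨T, hTS, hTfin, hT⟩ := exists_finite_subset_forall_exists_le S
  let φ : MvPolynomial (CoeffIndex d) k →+* K := (aeval b : _ →ₐ[k] K).toRingHom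
  have hlift : ∀ t : T, ∃ G ∈ genericIdeal d k, ∃ n, map φ G ∈ forms K n ∧ map φ G ≠ 0 ∧
      ord.degree (map φ G) = t := by
    rintro ⟨t, ht⟩
    obtain ⟨n, g, hg, hg0, hgt⟩ := Set.mem_iUnion.1 (hTS ht)
    obtain ⟨G, hG, c, hc, h⟩ := exists_map_eq_C_mul d b hb hg.2
    refine ⟨G, hG, n, ?_, ?_, ?_⟩
    · rw [h, ← smul_eq_C_mul]
      exact Submodule.smul_mem _ _ hg.1
    · rw [h]
      exact mul_ne_zero (by simpa using hc) hg0
    · rw [h, ord.degree_mul (by simpa using hc) hg0, ord.degree_C, zero_add, hgt]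
  choose G hG n hn hG0 hGt using hlift
  have := hTfin.fintype
  refine ⟨∏ t : T, coeff t (G t), ?_, fun a ha hfa m => ?_⟩
  · rw [map_prod, Finset.prod_ne_zero_iff]
    intro t _
    have h := ord.coeff_degree_ne_zero_iff.2 (hG0 t)
    rw [hGt, coeff_map] at h
    exact h
  rw [map_prod, Finset.prod_ne_zero_iff] at hfa
  rw [← ord.card_leadingExponents, ← ord.card_leadingExponents]
  refine Nat.card_mono (ord.finite_leadingExponents _) fun s hs => ?_
  obtain ⟨t, htT, hts⟩ := hT s (Set.mem_iUnion.2 ⟨m, hs⟩)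
  let t' : T := ⟨t, htT⟩
  let g := map (aeval a : _ →ₐ[k] k).toRingHom (G t')
  have hgI : g ∈ idealOfPoint d a := map_mem_idealOfPoint d a (hG t')
  have hcoeff : ∀ e, coeff e g = eval a (coeff e (G t')) := fun e => by
    rw [coeff_map]
    simp
  -- Relations at `b` hold at `a`, so specialising to `a` creates no new monomials: bihomogeneity
  -- persists and the leading exponent cannot grow.
  have hsub : ∀ e, coeff e g ≠ 0 → coeff e (map φ (G t')) ≠ 0 := fun e he h => by
    rw [coeff_map] at h
    exact he ((hcoeff e).trans (ha _ h))
  have hgt : coeff t g ≠ 0 := by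
    rw [hcoeff]
    exact hfa t' (Finset.mem_univ _)
  have hg0 : g ≠ 0 := fun h => hgt (by rw [h, coeff_zero])
  have hgn : g ∈ forms k (n t') := fun e he => hn t' (hsub e he)
  have hgdeg : ord.degree g = t := by
    refine ord.toSyn.injective (le_antisymm ?_ (ord.le_degree (mem_support_iff.2 hgt)))
    rw [ord.degree_le_iff]
    intro e he
    have := ord.le_degree (mem_support_iff.2 (hsub e (mem_support_iff.1 he)))
    rwa [hGt] at this
  obtain ⟨h, hh, hh0, hhs⟩ := hs
  have hsm : Finsupp.weight varDeg s = m := hh.1 (hhs ▸ ord.coeff_degree_ne_zero_iff.2 hh0)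
  have hmon : monomial (s - t) (1 : k) ≠ 0 := by simp
  -- A monomial multiple of `g` realises `s`.
  refine ⟨monomial (s - t) 1 * g, ⟨?_, Ideal.mul_mem_left _ _ hgI⟩, mul_ne_zero hmon hg0, ?_⟩
  · have := (isWeightedHomogeneous_monomial varDeg (s - t) (1 : k) rfl).mul hgn
    rwa [← hgn hgt, ← map_add, tsub_add_cancel_of_le hts, hsm] at this
  · rw [ord.degree_mul hmon hg0, hgdeg, ord.degree_monomial, if_neg one_ne_zero,
      tsub_add_cancel_of_le hts]


end Comparison

end BiProj

-- Finiteness by Noetherian induction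

universe u in
theorem MonomialOrder.nonempty_of_finite (σ : Type u) [Finite σ] :
    Nonempty (MonomialOrder.{u, u} σ) := by
  classical
  let : LinearOrder σ := linearOrderOfSTO WellOrderingRel
  exact ⟨MonomialOrder.lex⟩

namespace BiProj

section Finiteness

universe u

variable {r : ℕ} (d : Fin r → ℕ × ℕ) {k : Type u} [Field k]

/-- The points of an irreducible closed set at which some polynomial does not vanish have the same
Hilbert series. -/
theorem exists_notMem_forall_hilbertSeries_eq (J : Ideal (MvPolynomial (CoeffIndex d) k))
    [J.IsPrime] : ∃ f ∉ J, ∀ a a' : CoeffIndex d → k,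
      (∀ p ∈ J, eval a p = 0) → (∀ p ∈ J, eval a' p = 0) → eval a f ≠ 0 → eval a' f ≠ 0 →
        hilbertSeries (idealOfPoint d a) = hilbertSeries (idealOfPoint d a') := by
  let K := FractionRing (MvPolynomial (CoeffIndex d) k ⧸ J)
  let ψ : MvPolynomial (CoeffIndex d) k →ₐ[k] K :=
    (IsScalarTower.toAlgHom k (MvPolynomial (CoeffIndex d) k ⧸ J) K).comp (Ideal.Quotient.mkₐ k J)
  let b : CoeffIndex d → K := fun i => ψ (X i)
  have hbψ : aeval b = ψ := (aeval_unique ψ).symm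
  have hψ : ∀ p, ψ p = algebraMap (MvPolynomial (CoeffIndex d) k ⧸ J) K (Ideal.Quotient.mk J p) :=
    fun p => rfl
  have hker : ∀ p, aeval b p = 0 ↔ p ∈ J := fun p => by
    rw [hbψ, hψ, FaithfulSMul.algebraMap_eq_zero_iff, Ideal.Quotient.eq_zero_iff_mem]
  have hb : ∀ x : K, ∃ u v : MvPolynomial (CoeffIndex d) k,
      aeval b v ≠ 0 ∧ x * aeval b v = aeval b u := fun x => by
    obtain ⟨u, v, hv, rfl⟩ := IsFractionRing.div_surjective (MvPolynomial (CoeffIndex d) k ⧸ J) x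
    obtain ⟨u, rfl⟩ := Ideal.Quotient.mk_surjective u
    obtain ⟨v, rfl⟩ := Ideal.Quotient.mk_surjective v
    have hv0 : ψ v ≠ 0 := by
      rw [hψ]
      exact IsFractionRing.to_map_ne_zero_of_mem_nonZeroDivisors hv
    refine ⟨u, v, by rwa [hbψ], ?_⟩
    rw [hbψ, ← hψ, ← hψ, div_mul_cancel₀ _ hv0]
  obtain ⟨ord⟩ := MonomialOrder.nonempty_of_finite (Fin 2 ⊕ Fin 2)
  obtain ⟨f, hf, hfa⟩ := exists_aeval_ne_zero_forall_finrank_le d ord b hb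
  have hgen : ∀ a : CoeffIndex d → k, (∀ p ∈ J, eval a p = 0) → eval a f ≠ 0 → ∀ m,
      Module.finrank k (idealPiece (idealOfPoint d a) m) =
        Module.finrank K (idealPiece (idealOfPoint d b) m) := fun a ha haf m => by
    refine le_antisymm ?_ (hfa a (fun p hp => ha p ((hker p).1 hp)) haf m)
    -- Here `p` depends on `m`, but it need only be nonzero at `b`, which is automatic because `p ∉
    -- J`. No infinite intersection of open sets arises.
    obtain ⟨p, hp, hpK⟩ := exists_eval_ne_zero_forall_finrank_le d a m
    exact hpK K b fun h => hp (ha p ((hker p).1 h))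
  refine ⟨f, fun h => hf ((hker f).2 h), fun a a' ha ha' haf haf' => ?_⟩
  funext s
  have h := finrank_quotPiece_add (idealOfPoint d a) (s 0, s 1)
  have h' := finrank_quotPiece_add (idealOfPoint d a') (s 0, s 1)
  rw [hgen a ha haf] at h
  rw [hgen a' ha' haf', ← h] at h'
  exact (Nat.add_right_cancel h').symm

theorem finite_image_hilbertSeries (J : Ideal (MvPolynomial (CoeffIndex d) k)) :
    ((fun a => hilbertSeries (idealOfPoint d a)) ''
      {a : CoeffIndex d → k | ∀ p ∈ J, eval a p = 0}).Finite := by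
  induction J using IsNoetherian.induction with
  | hgt J ih =>
    change Ideal _ at J
    have ih' : ∀ f ∉ J, ((fun a => hilbertSeries (idealOfPoint d a)) ''
        {a : CoeffIndex d → k | (∀ p ∈ J, eval a p = 0) ∧ eval a f = 0}).Finite := fun f hf => by
      have hlt : J < J ⊔ Ideal.span {f} := lt_of_le_of_ne le_sup_left fun h =>
        hf (h ▸ Ideal.mem_sup_right (Ideal.mem_span_singleton_self f))
      refine (ih _ hlt).subset (Set.image_mono fun a ha p hp => ?_)
      have hle : J ⊔ Ideal.span {f} ≤ RingHom.ker (eval a) :=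
        sup_le ha.1 ((Ideal.span_singleton_le_iff_mem _).2 ha.2)
      exact hle hp
    by_cases hJ : J.IsPrime
    · obtain ⟨f, hf, hfa⟩ := exists_notMem_forall_hilbertSeries_eq d J
      have hsub : ((fun a => hilbertSeries (idealOfPoint d a)) ''
          {a : CoeffIndex d → k | (∀ p ∈ J, eval a p = 0) ∧ eval a f ≠ 0}).Subsingleton := by
        rintro _ ⟨a, ha, rfl⟩ _ ⟨a', ha', rfl⟩
        exact hfa a a' ha.1 ha'.1 ha.2 ha'.2
      refine ((ih' f hf).union hsub.finite).subset ?_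
      rw [← Set.image_union]
      refine Set.image_mono fun a ha => ?_
      by_cases h : eval a f = 0
      · exact Or.inl ⟨ha, h⟩
      · exact Or.inr ⟨ha, h⟩
    · rw [Ideal.not_isPrime_iff] at hJ
      obtain rfl | ⟨x, hx, y, hy, hxy⟩ := hJ
      · convert Set.finite_empty
        rw [Set.image_eq_empty, Set.eq_empty_iff_forall_notMem]
        intro a ha
        simpa using ha 1 trivial
      · refine ((ih' x hx).union (ih' y hy)).subset ?_
        rw [← Set.image_union]
        refine Set.image_mono fun a ha => ?_
        have h := ha _ hxy
        rw [map_mul, mul_eq_zero] at h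
        exact h.imp (fun h => ⟨ha, h⟩) fun h => ⟨ha, h⟩

theorem finite_hilbertSeries_image_idealSpace :
    (hilbertSeries '' idealSpace k d).Finite := by
  have h := finite_image_hilbertSeries d (k := k) ⊥
  rw [idealSpace_eq_range, ← Set.range_comp, ← Set.image_univ]
  refine h.subset (Set.image_mono fun a _ p hp => ?_)
  rw [Ideal.mem_bot.1 hp, map_zero]

/-- Upper semicontinuity of the Hilbert function. -/
theorem exists_eval_ne_zero_forall_hilbertSeries_le (a : CoeffIndex d → k) (s : Fin 2 →₀ ℕ) :
    ∃ p : MvPolynomial (CoeffIndex d) k, eval a p ≠ 0 ∧ ∀ b : CoeffIndex d → k, eval b p ≠ 0 →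
      hilbertSeries (idealOfPoint d b) s ≤ hilbertSeries (idealOfPoint d a) s := by
  obtain ⟨p, hp, hpK⟩ := exists_eval_ne_zero_forall_finrank_le d a (s 0, s 1)
  refine ⟨p, hp, fun b hb => ?_⟩
  have h := finrank_quotPiece_add (idealOfPoint d a) (s 0, s 1)
  have h' := finrank_quotPiece_add (idealOfPoint d b) (s 0, s 1)
  have hle := hpK k b (by rwa [aeval_eq_eval])
  change Module.finrank k (quotPiece _ (s 0, s 1)) ≤ Module.finrank k (quotPiece _ (s 0, s 1))
  omega

end Finiteness

end BiProj

/-! ### The minimal series and its open set -/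

theorem mainTheorem1 (k : Type*) [Field k] [Infinite k] (r : ℕ) (d : Fin r → ℕ × ℕ) :
    (BiProj.hilbertSeries '' BiProj.idealSpace k d).Finite ∧
    ∃ (U : Set (BiProj.CoeffIndex d → k)) (H : MvPowerSeries (Fin 2) ℕ),
      BiProj.IsZariskiOpen U ∧ U.Nonempty ∧
      (∀ a ∈ U, BiProj.hilbertSeries (BiProj.idealOfPoint d a) = H) ∧
      H ∈ BiProj.hilbertSeries '' BiProj.idealSpace k d ∧
      ∀ I ∈ BiProj.idealSpace k d, BiProj.TermwiseLE H (BiProj.hilbertSeries I) := by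
  classical
  have hfin := BiProj.finite_hilbertSeries_image_idealSpace (k := k) d
  refine ⟨hfin, ?_⟩
  rw [BiProj.idealSpace_eq_range, ← Set.range_comp] at hfin ⊢
  let h : (BiProj.CoeffIndex d → k) → MvPowerSeries (Fin 2) ℕ :=
    fun a => BiProj.hilbertSeries (BiProj.idealOfPoint d a)
  choose a₀ ha₀ using fun s : Fin 2 →₀ ℕ =>
    (⟨Function.argmin fun a => h a s, fun a => Function.argmin_le (fun a => h a s) a⟩ : ∃ a₀, ∀ a, h a₀ s ≤ h a s)
  choose p hp hph using fun s => BiProj.exists_eval_ne_zero_forall_hilbertSeries_le d (a₀ s) s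
  have hp0 : ∀ s, p s ≠ 0 := fun s h => hp s (by rw [h, map_zero])
  let H : MvPowerSeries (Fin 2) ℕ := fun s => h (a₀ s) s
  have hH : ∀ a, (∀ s, eval a (p s) ≠ 0 → h a s = H s) := fun a s hs =>
    le_antisymm (hph s a hs) (ha₀ s a)
  -- A bidegree separating `G` from `H`; the value `0` for `G = H` is arbitrary.
  have hex : ∀ G : MvPowerSeries (Fin 2) ℕ, ∃ s, G ≠ H → G s ≠ H s := fun G => by
    by_cases hG : G = H
    · exact ⟨0, fun h => absurd hG h⟩
    · obtain ⟨s, hs⟩ := Function.ne_iff.1 hG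
      exact ⟨s, fun _ => hs⟩
  choose s hs using hex
  let q := ∏ G ∈ hfin.toFinset, p (s G)
  have hq0 : q ≠ 0 := Finset.prod_ne_zero_iff.2 fun G _ => hp0 _
  have hqH : ∀ a, eval a q ≠ 0 → h a = H := fun a ha => by
    by_contra hne
    rw [map_prod, Finset.prod_ne_zero_iff] at ha
    exact hs _ hne (hH a _ (ha (h a) (hfin.mem_toFinset.2 ⟨a, rfl⟩)))
  -- Over an infinite field a nonzero polynomial has a nonzero value.
  obtain ⟨a, ha⟩ : ∃ a, eval a q ≠ 0 := by
    by_contra! hall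
    exact hq0 (MvPolynomial.funext fun a => by rw [hall a, map_zero])
  refine ⟨{a | eval a q ≠ 0}, H, ⟨{q}, ?_⟩, ⟨a, ha⟩, hqH, ⟨a, hqH a ha⟩, ?_⟩
  · ext a
    simp
  · rintro _ ⟨b, rfl⟩ s
    exact ha₀ s b
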